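/- Let $1\le p<\infty$, $p\neq 2$, let $D$ be the open unit disc, $T$ the unit circle with normalized Lebesgue measure $m$, and let $H^p$ be the Hardy space of analytic functions $f$ on $D$ with $\|f\|_p^p=\sup_{0<r<1}\int_T|f(r\zeta)|^p\,dm(\zeta)<\infty$. Let $\phi(z)=\frac{\lambda(z-a)}{1-\overline a z}$ and $\psi(z)=\frac{\mu(z-c)}{1-\overline c z}$, with $a,c\in D$ and $|\lambda|=|\mu|=1$, be automorphisms of $D$, and suppose that $\phi$ is parabolic, i.e. $\phi$ has exactly one fixed point in $\overline D$ and this point lies on $T$. Write $\phi_n$ for the $n$-fold composition of $\phi$ with itself ($\phi_0(z)=z$), and let $$ S f = M_\psi U_\phi f=\psi\cdot(\overline\lambda\,\phi')^{1/p}\cdot (f\circ\phi) ,$$ where the principal branch of the $p$-th root is used. Then $S$ is a linear isometry of $H^p$ into $H^p$ whose range has codimension one, but $S$ is not Crownover, that is, $\bigcap_{n=1}^\infty S^nH^p\neq(0)$. Moreover, for every $n\ge 0$ the function $\psi\circ\phi_n$ has exactly one zero $b_n$ in $D$, and $(b_n)$ is a Blaschke sequence: $\sum_{n=0}^\infty(1-|b_n|)<\infty$.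 -/

import Mathlib

noncomputable section

namespace HardyIsometry

open Complex ComplexConjugate Metric Set

/-- A holomorphic automorphism `z ↦ lam * (z - a) / (1 - conj a * z)` of the unit disc, recorded by
its (uniquely determined) parameters `a` in the open disc and `lam` on the unit circle. -/
structure DiscAut where
  /-- the unimodular factor -/
  lam : Circle
  /-- the zero of the automorphism -/
  a : UnitDisc

/-- The automorphism as a rational function; its only pole lies outside the closed disc. -/
def DiscAut.toFun (φ : DiscAut) (z : ℂ) : ℂ :=
  (φ.lam : ℂ) * (z - (φ.a : ℂ)) / (1 - conj (φ.a : ℂ) * z)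

theorem DiscAut.norm_toFun_lt_one (φ : DiscAut) {z : ℂ} (hz : ‖z‖ < 1) : ‖φ.toFun z‖ < 1 := by
  have ha : ‖(φ.a : ℂ)‖ < 1 := φ.a.norm_lt_one
  have hne : 1 - conj (φ.a : ℂ) * z ≠ 0 := by
    intro h
    have h1 : ‖conj (φ.a : ℂ) * z‖ = 1 := by
      rw [← sub_eq_zero.mp h, norm_one]
    rw [norm_mul, RCLike.norm_conj] at h1
    nlinarith [norm_nonneg (φ.a : ℂ), norm_nonneg z]
  have hpos : 0 < ‖1 - conj (φ.a : ℂ) * z‖ := norm_pos_iff.mpr hne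
  rw [DiscAut.toFun, norm_div, norm_mul, Circle.norm_coe, one_mul, div_lt_one hpos]
  refine lt_of_pow_lt_pow_left₀ 2 hpos.le ?_
  have key : ‖1 - conj (φ.a : ℂ) * z‖ ^ 2 - ‖z - (φ.a : ℂ)‖ ^ 2
      = (1 - ‖z‖ ^ 2) * (1 - ‖(φ.a : ℂ)‖ ^ 2) := by
    simp only [← Complex.normSq_eq_norm_sq, Complex.normSq_apply]
    simp
    ring
  have h1 : 0 < 1 - ‖z‖ ^ 2 := by nlinarith [norm_nonneg z]
  have h2 : 0 < 1 - ‖(φ.a : ℂ)‖ ^ 2 := by nlinarith [norm_nonneg (φ.a : ℂ)]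
  nlinarith [mul_pos h1 h2]

/-- The automorphism as a self-map of the open unit disc. -/
def DiscAut.onDisc (φ : DiscAut) (z : UnitDisc) : UnitDisc :=
  UnitDisc.mk (φ.toFun z) (φ.norm_toFun_lt_one z.norm_lt_one)

/-- `φ` is parabolic: it has exactly one fixed point in the closed unit disc, and this point lies
on the unit circle. -/
def DiscAut.IsParabolic (φ : DiscAut) : Prop :=
  ∃ w : ℂ, ‖w‖ = 1 ∧ φ.toFun w = w ∧ ∀ z : ℂ, ‖z‖ ≤ 1 → φ.toFun z = z → z = w

/-- Extension by zero of a function on the open unit disc to the plane. -/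
def extend (f : UnitDisc → ℂ) : ℂ → ℂ :=
  Function.extend (fun z : UnitDisc => (z : ℂ)) f 0

/-- The integral mean `∫_T |f(rζ)|^p dm(ζ)`, with `m` the normalized Lebesgue measure. -/
def pMean (p : ℝ) (f : UnitDisc → ℂ) (r : ℝ) : ℝ :=
  Real.circleAverage (fun z => ‖extend f z‖ ^ p) 0 r

theorem extend_apply (f : UnitDisc → ℂ) (z : UnitDisc) : extend f z = f z :=
  UnitDisc.coe_injective.extend_apply f 0 z

theorem extend_add (f g : UnitDisc → ℂ) : extend (f + g) = extend f + extend g := by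
  simpa [extend] using Function.extend_add (fun z : UnitDisc => (z : ℂ)) f g 0 0

theorem extend_smul (c : ℂ) (f : UnitDisc → ℂ) : extend (c • f) = c • extend f := by
  simpa [extend] using Function.extend_smul c (fun z : UnitDisc => (z : ℂ)) f 0

theorem extend_zero : extend 0 = 0 := by
  simpa using extend_smul 0 0

theorem circleIntegrable_norm_rpow {p : ℝ} (hp : 1 ≤ p) {F : ℂ → ℂ}
    (hF : ContinuousOn F (ball 0 1)) {r : ℝ} (hr : r ∈ Ioo (0 : ℝ) 1) :
    CircleIntegrable (fun z => ‖F z‖ ^ p) 0 r := by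
  refine ContinuousOn.circleIntegrable hr.1.le ?_
  refine ContinuousOn.rpow_const (hF.mono ?_).norm (fun _ _ => Or.inr (by linarith))
  exact sphere_subset_closedBall.trans (closedBall_subset_ball hr.2)

theorem pMean_add_le {p : ℝ} (hp : 1 ≤ p) {f g : UnitDisc → ℂ}
    (hf : ContinuousOn (extend f) (ball 0 1)) (hg : ContinuousOn (extend g) (ball 0 1))
    {r : ℝ} (hr : r ∈ Ioo (0 : ℝ) 1) :
    pMean p (f + g) r ≤ 2 ^ (p - 1) * (pMean p f r + pMean p g r) := by
  have hif := circleIntegrable_norm_rpow hp hf hr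
  have hig := circleIntegrable_norm_rpow hp hg hr
  have h2 : (2 : ℝ) ^ (p - 1) * (pMean p f r + pMean p g r) = Real.circleAverage
      ((2 : ℝ) ^ (p - 1) • ((fun z => ‖extend f z‖ ^ p) + fun z => ‖extend g z‖ ^ p)) 0 r := by
    rw [Real.circleAverage_smul, Real.circleAverage_add hif hig]
    rfl
  rw [h2]
  refine Real.circleAverage_mono ?_ ((hif.add hig).const_smul) ?_
  · rw [extend_add]
    exact circleIntegrable_norm_rpow hp (hf.add hg) hr
  · intro z _
    simp only [extend_add, Pi.add_apply, Pi.smul_apply, smul_eq_mul]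
    exact (Real.rpow_le_rpow (norm_nonneg _) (norm_add_le _ _) (by linarith)).trans
      (by exact_mod_cast NNReal.rpow_add_le_mul_rpow_add_rpow ‖extend f z‖₊ ‖extend g z‖₊ hp)

/-- The Hardy space `H^p` of the unit disc: the analytic functions on the disc whose `p`-means over
the circles of radius `r < 1` are bounded. -/
def hardySpace (p : ℝ) (hp : 1 ≤ p) : Submodule ℂ (UnitDisc → ℂ) where
  carrier := {f | DifferentiableOn ℂ (extend f) (ball 0 1) ∧
    BddAbove (pMean p f '' Ioo (0 : ℝ) 1)}
  add_mem' := by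
    rintro f g ⟨hf, A, hA⟩ ⟨hg, B, hB⟩
    refine ⟨by rw [extend_add]; exact hf.add hg, 2 ^ (p - 1) * (A + B), ?_⟩
    rintro _ ⟨r, hr, rfl⟩
    refine (pMean_add_le hp hf.continuousOn hg.continuousOn hr).trans ?_
    have h1 := hA ⟨r, hr, rfl⟩
    have h2 := hB ⟨r, hr, rfl⟩
    gcongr
  zero_mem' := by
    refine ⟨by rw [extend_zero]; exact differentiableOn_const 0, 0, ?_⟩
    rintro _ ⟨r, _, rfl⟩
    simp [pMean, extend_zero, Real.zero_rpow (by linarith : p ≠ 0), Real.circleAverage_const]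
  smul_mem' := by
    rintro c f ⟨hf, A, hA⟩
    refine ⟨by rw [extend_smul]; exact hf.const_smul c, ‖c‖ ^ p * A, ?_⟩
    rintro _ ⟨r, hr, rfl⟩
    have h : pMean p (c • f) r = ‖c‖ ^ p * pMean p f r := by
      unfold pMean
      rw [← smul_eq_mul, ← Real.circleAverage_smul]
      congr 1
      ext z
      simp [extend_smul, Real.mul_rpow (norm_nonneg c) (norm_nonneg _)]
    rw [h]
    have h1 := hA ⟨r, hr, rfl⟩
    gcongr

/-- The norm of `H^p`. -/
def hardyNorm (p : ℝ) (f : UnitDisc → ℂ) : ℝ :=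
  sSup (pMean p f '' Ioo (0 : ℝ) 1) ^ (1 / p)

/-- The operator `M_F` of multiplication by `F`. -/
def mulOp (F : UnitDisc → ℂ) : Module.End ℂ (UnitDisc → ℂ) :=
  LinearMap.mulLeft ℂ F

/-- The operator `C_φ` of composition with `φ`. -/
def compOp (φ : DiscAut) : Module.End ℂ (UnitDisc → ℂ) :=
  LinearMap.funLeft ℂ ℂ φ.onDisc

/-- The operator `U_φ f = (conj lam * φ')^(1/p) * (f ∘ φ)`, with the principal branch. -/
def weightedCompOp (p : ℝ) (φ : DiscAut) : Module.End ℂ (UnitDisc → ℂ) :=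
  mulOp (fun z => (conj (φ.lam : ℂ) * deriv φ.toFun z) ^ ((1 / p : ℝ) : ℂ)) * compOp φ

/-- The linear operator `S` restricts to an isometry of `H^p` into itself whose range has
codimension one in `H^p`. -/
structure IsCodimOneIsometry (p : ℝ) (hp : 1 ≤ p) (S : Module.End ℂ (UnitDisc → ℂ)) : Prop where
  mapsTo : ∀ f ∈ hardySpace p hp, S f ∈ hardySpace p hp
  norm_map : ∀ f ∈ hardySpace p hp, hardyNorm p (S f) = hardyNorm p f
  codim : Module.finrank ℂ
    (hardySpace p hp ⧸ ((hardySpace p hp).map S).submoduleOf (hardySpace p hp)) = 1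

/-- `S` is Crownover: a codimension one isometry of `H^p` with `⋂_{n ≥ 1} S^n H^p = (0)`. -/
def IsCrownover (p : ℝ) (hp : 1 ≤ p) (S : Module.End ℂ (UnitDisc → ℂ)) : Prop :=
  IsCodimOneIsometry p hp S ∧
    (⨅ n : ℕ, (hardySpace p hp).map (S ^ (n + 1))) = ⊥

end HardyIsometry

end

/-!
The automorphism `φ` acts isometrically through `U_φ` because `|weight|^p = |φ'|` is the Jacobian of
`φ` on the unit circle and the integral means of an analytic function increase with the radius; the
same operator built from the inverse automorphism inverts `U_φ`. Multiplication by `ψ` preserves the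
supremum of the means because `|ψ| = 1` on the circle, and its range consists of the functions
vanishing at the zero of `ψ`, which has codimension one. In the half-plane coordinate `C` sending
the fixed point of `φ` to infinity, `φ` is translation by a real `t ≠ 0`. The zeros
`b_n = φ⁻ⁿ(ψ⁻¹(0))` therefore form a horizontal arithmetic progression, so that `1 - |b_n|` is of
order `n⁻²`, and for a bounded `t`-periodic function `q` on the half-plane `q ∘ C - q (C b_0)`
vanishes at every `b_n` and hence lies in the range of every power of `M_ψ U_φ`.
-/

namespace HardyIsometry

open Complex ComplexConjugate Metric Set Real MeasureTheory Filter Topology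

section CircleAverage

variable {E : Type*} [NormedAddCommGroup E] [NormedSpace ℝ E]

theorem circleAverage_comp_mul_right (h : ℂ → E) (z : ℂ) :
    circleAverage (fun u => h (u * z)) 0 1 = circleAverage h 0 ‖z‖ := by
  have hrot (θ : ℝ) : circleMap 0 1 θ * z = circleMap 0 ‖z‖ (θ + arg z) := by
    conv_lhs => rw [← norm_mul_exp_arg_mul_I z]
    simp only [circleMap_zero, ofReal_one, one_mul, ofReal_add, add_mul, Complex.exp_add]
    ring
  rw [circleAverage_eq_integral_add (f := h) (arg z), circleAverage_def]
  simp only [hrot]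

theorem circleAverage_circleAverage_swap {F : ℂ → ℂ → E} {c d : ℂ} {r R : ℝ}
    (hF : ContinuousOn (Function.uncurry F) (sphere c |r| ×ˢ sphere d |R|)) :
    circleAverage (fun u => circleAverage (F u) d R) c r =
      circleAverage (fun z => circleAverage (fun u => F u z) c r) d R := by
  have hc : Continuous fun x : ℝ × ℝ => F (circleMap c r x.1) (circleMap d R x.2) :=
    hF.comp_continuous (f := fun x : ℝ × ℝ => (circleMap c r x.1, circleMap d R x.2))
      (by fun_prop) fun x => ⟨circleMap_mem_sphere' _ _ _, circleMap_mem_sphere' _ _ _⟩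
  simp only [circleAverage_def, intervalIntegral.integral_smul]
  rw [intervalIntegral_intervalIntegral_swap]
  exact (hc.continuousOn.integrableOn_compact (isCompact_uIcc.prod isCompact_uIcc)).mono_set
    (prod_mono uIoc_subset_uIcc uIoc_subset_uIcc)

theorem continuousOn_circleAverage {X : Type*} [TopologicalSpace X] {F : X → ℂ → E} {s : Set X}
    {c : ℂ} {R : ℝ} (hF : ContinuousOn (Function.uncurry F) (s ×ˢ sphere c |R|)) :
    ContinuousOn (fun x => circleAverage (F x) c R) s := by
  rw [continuousOn_iff_continuous_domRestrict]
  have hc : Continuous (Function.uncurry fun (x : s) (θ : ℝ) => F x (circleMap c R θ)) :=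
    hF.comp_continuous (f := fun y : s × ℝ => ((y.1 : X), circleMap c R y.2))
      (by fun_prop) fun y => ⟨y.1.2, circleMap_mem_sphere' _ _ _⟩
  exact (intervalIntegral.continuous_parametric_intervalIntegral_of_continuous' hc 0
    (2 * π)).const_smul (2 * π)⁻¹

/-- The measure on the angles `θ ∈ (0, 2π]` with density `K` along the circle, relative to the
normalized Lebesgue measure; it turns weighted circle averages into integrals. -/
noncomputable def circleWeightMeasure (K : ℂ → ℝ) (c : ℂ) (R : ℝ) : Measure ℝ :=
  (volume.restrict (Ioc 0 (2 * π))).withDensity fun θ =>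
    ENNReal.ofReal ((2 * π)⁻¹ * K (circleMap c R θ))

variable {K : ℂ → ℝ} {c : ℂ} {R : ℝ}

theorem measurable_circleWeight (hK : ContinuousOn K (sphere c |R|)) :
    Measurable fun θ => ENNReal.ofReal ((2 * π)⁻¹ * K (circleMap c R θ)) :=
  ((hK.comp_continuous (continuous_circleMap c R)
    (circleMap_mem_sphere' c R)).measurable.const_mul _).ennreal_ofReal

theorem toReal_circleWeight (hK0 : ∀ z ∈ sphere c |R|, 0 ≤ K z) (θ : ℝ) :
    (ENNReal.ofReal ((2 * π)⁻¹ * K (circleMap c R θ))).toReal =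
      (2 * π)⁻¹ * K (circleMap c R θ) :=
  ENNReal.toReal_ofReal (mul_nonneg (by positivity) (hK0 _ (circleMap_mem_sphere' c R θ)))

theorem integral_circleWeightMeasure (hK : ContinuousOn K (sphere c |R|))
    (hK0 : ∀ z ∈ sphere c |R|, 0 ≤ K z) (h : ℂ → E) :
    ∫ θ, h (circleMap c R θ) ∂circleWeightMeasure K c R = circleAverage (K • h) c R := by
  rw [circleWeightMeasure, integral_withDensity_eq_integral_toReal_smul
    (measurable_circleWeight hK) (ae_of_all _ fun _ => ENNReal.ofReal_lt_top), circleAverage_def,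
    intervalIntegral.integral_of_le (by positivity), ← integral_smul]
  simp only [toReal_circleWeight hK0, Pi.smul_apply', mul_smul]

theorem integrable_circleWeightMeasure (hK : ContinuousOn K (sphere c |R|))
    (hK0 : ∀ z ∈ sphere c |R|, 0 ≤ K z) {h : ℂ → E} (hh : ContinuousOn h (sphere c |R|)) :
    Integrable (fun θ => h (circleMap c R θ)) (circleWeightMeasure K c R) := by
  rw [circleWeightMeasure, integrable_withDensity_iff_integrable_smul'
    (measurable_circleWeight hK) (ae_of_all _ fun _ => ENNReal.ofReal_lt_top)]
  simp only [toReal_circleWeight hK0]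
  refine Continuous.integrableOn_Ioc (Continuous.smul (continuous_const.mul ?_) ?_)
  · exact hK.comp_continuous (continuous_circleMap c R) (circleMap_mem_sphere' c R)
  · exact hh.comp_continuous (continuous_circleMap c R) (circleMap_mem_sphere' c R)

theorem isProbabilityMeasure_circleWeightMeasure (hK : ContinuousOn K (sphere c |R|))
    (hK0 : ∀ z ∈ sphere c |R|, 0 ≤ K z) (hK1 : circleAverage K c R = 1) :
    IsProbabilityMeasure (circleWeightMeasure K c R) := by
  have h := integral_circleWeightMeasure hK hK0 (1 : ℂ → ℝ)
  simp only [Pi.one_apply, smul_eq_mul, mul_one, hK1, integral_const] at h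
  exact ⟨(ENNReal.toReal_eq_one_iff _).mp h⟩

theorem map_circleAverage_smul_le [CompleteSpace E] {g : E → ℝ} (hg : ConvexOn ℝ univ g)
    (hgc : Continuous g) (hK : ContinuousOn K (sphere c |R|)) (hK0 : ∀ z ∈ sphere c |R|, 0 ≤ K z)
    (hK1 : circleAverage K c R = 1) {f : ℂ → E} (hf : ContinuousOn f (sphere c |R|)) :
    g (circleAverage (K • f) c R) ≤ circleAverage (K • (g ∘ f)) c R := by
  have := isProbabilityMeasure_circleWeightMeasure hK hK0 hK1
  rw [← integral_circleWeightMeasure hK hK0 f, ← integral_circleWeightMeasure hK hK0 (g ∘ f)]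
  exact hg.map_integral_le hgc.continuousOn isClosed_univ (by simp)
    (integrable_circleWeightMeasure hK hK0 hf)
    (integrable_circleWeightMeasure (h := g ∘ f) hK hK0 (hgc.comp_continuousOn hf))

theorem convexOn_norm_rpow {p : ℝ} (hp : 1 ≤ p) : ConvexOn ℝ univ fun x : E => ‖x‖ ^ p := by
  refine ⟨convex_univ, fun x hx y hy a b ha hb hab => ?_⟩
  calc ‖a • x + b • y‖ ^ p ≤ (a • ‖x‖ + b • ‖y‖) ^ p := by
        gcongr
        exact convexOn_univ_norm.2 hx hy ha hb hab
    _ ≤ a • ‖x‖ ^ p + b • ‖y‖ ^ p :=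
        (convexOn_rpow hp).2 (norm_nonneg x) (norm_nonneg y) ha hb hab

end CircleAverage

section Subharmonicity

variable {E : Type*} [NormedAddCommGroup E] [NormedSpace ℂ E] {c w : ℂ} {p R : ℝ}

theorem continuousOn_poissonKernel_sphere (hw : w ∈ ball c R) :
    ContinuousOn (poissonKernel c w) (sphere c |R|) := by
  rw [poissonKernel_eq_re_herglotzRieszKernel]
  exact Complex.continuous_re.comp_continuousOn (continuousOn_herglotzRieszKernel_sphere hw)

theorem poissonKernel_nonneg_of_mem_sphere {z : ℂ} (hw : w ∈ ball c R) (hz : z ∈ sphere c |R|) :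
    0 ≤ poissonKernel c w z := by
  have hwz : ‖w - c‖ ≤ ‖z - c‖ := by
    rw [mem_sphere_iff_norm.mp hz]
    exact (mem_ball_iff_norm.mp hw).le.trans (le_abs_self R)
  rw [poissonKernel_def]
  exact div_nonneg (sub_nonneg.mpr (by gcongr)) (by positivity)

theorem circleAverage_poissonKernel (hw : w ∈ ball c R) :
    circleAverage (poissonKernel c w) c R = 1 := by
  have h := InnerProductSpace.HarmonicOnNhd.circleAverage_poissonKernel_smul
    (f := fun _ => (1 : ℝ)) (fun z _ => InnerProductSpace.harmonicAt_const (1 : ℝ)) hw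
  rwa [← Pi.one_def, smul_eq_mul, mul_one] at h

theorem norm_rpow_le_circleAverage_poissonKernel [CompleteSpace E] (hp : 1 ≤ p) {f : ℂ → E}
    (hf : DiffContOnCl ℂ f (ball c R)) (hw : w ∈ ball c R) :
    ‖f w‖ ^ p ≤ circleAverage (fun z => poissonKernel c w z * ‖f z‖ ^ p) c R := by
  have hR : |R| = R := abs_of_pos (pos_of_mem_ball hw)
  have hfc : ContinuousOn f (sphere c |R|) := by
    rw [hR]
    exact hf.continuousOn_ball.mono sphere_subset_closedBall
  rw [← hf.circleAverage_poissonKernel_smul hw]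
  exact map_circleAverage_smul_le (convexOn_norm_rpow hp)
    (continuous_norm.rpow_const fun _ => Or.inr (by linarith))
    (continuousOn_poissonKernel_sphere hw)
    (fun z => poissonKernel_nonneg_of_mem_sphere hw) (circleAverage_poissonKernel hw) hfc

-- Average the Poisson bound for the rotations `z ↦ f (u * z)` over `|u| = 1` and swap the averages:
-- the mean over `u` depends only on `|z|`, which leaves the mean of the Poisson kernel.
theorem circleAverage_norm_rpow_le [CompleteSpace E] (hp : 1 ≤ p) {f : ℂ → E}
    (hf : DiffContOnCl ℂ f (ball 0 R)) {s : ℝ} (hs : 0 ≤ s) (hsR : s < R) :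
    circleAverage (fun z => ‖f z‖ ^ p) 0 s ≤ circleAverage (fun z => ‖f z‖ ^ p) 0 R := by
  have hR : |R| = R := abs_of_pos (hs.trans_lt hsR)
  have hw : (s : ℂ) ∈ ball (0 : ℂ) R := by simpa [abs_of_nonneg hs] using hsR
  have hcl : ContinuousOn (fun x : ℂ × ℂ => ‖f (x.1 * x.2)‖ ^ p)
      (sphere 0 |1| ×ˢ closedBall 0 |R|) := by
    refine ContinuousOn.rpow_const (hf.continuousOn_ball.comp
      (f := fun x : ℂ × ℂ => x.1 * x.2) (by fun_prop) ?_).norm fun _ _ => Or.inr (by linarith)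
    rintro ⟨u, z⟩ ⟨hu, hz⟩
    rw [hR] at hz
    simp_all
  have hrot : ContinuousOn (Function.uncurry fun u z : ℂ => poissonKernel 0 s z * ‖f (u * z)‖ ^ p)
      (sphere 0 |1| ×ˢ sphere 0 |R|) :=
    ((continuousOn_poissonKernel_sphere hw).comp continuousOn_snd fun x hx => hx.2).mul
      (hcl.mono (prod_mono subset_rfl sphere_subset_closedBall))
  calc circleAverage (fun z => ‖f z‖ ^ p) 0 s
      = circleAverage (fun u => ‖f (u * s)‖ ^ p) 0 1 := by
        rw [circleAverage_comp_mul_right (fun z => ‖f z‖ ^ p), norm_real, Real.norm_of_nonneg hs]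
    _ ≤ circleAverage (fun u => circleAverage
          (fun z => poissonKernel 0 s z * ‖f (u * z)‖ ^ p) 0 R) 0 1 := by
        refine circleAverage_mono (ContinuousOn.circleIntegrable' ?_)
          (continuousOn_circleAverage hrot).circleIntegrable' fun u hu => ?_
        · refine hcl.comp (f := fun u : ℂ => (u, (s : ℂ))) (by fun_prop) fun u hu => ⟨hu, ?_⟩
          simpa [hR, abs_of_nonneg hs] using hsR.le
        · have hu1 : ‖u‖ = 1 := by simpa using hu
          have hfu : DiffContOnCl ℂ (fun z => f (u * z)) (ball 0 R) :=
            hf.comp (Differentiable.diffContOnCl (by fun_prop)) fun z hz => by simpa [hu1] using hz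
          exact norm_rpow_le_circleAverage_poissonKernel hp hfu hw
    _ = circleAverage (fun z => circleAverage
          (fun u => poissonKernel 0 s z * ‖f (u * z)‖ ^ p) 0 1) 0 R :=
        circleAverage_circleAverage_swap hrot
    _ = circleAverage (fun z => circleAverage (fun z => ‖f z‖ ^ p) 0 R • poissonKernel 0 s z)
          0 R := by
        refine circleAverage_congr_sphere fun z hz => ?_
        have hz' : ‖z‖ = R := by simpa [hR] using hz
        simp only [← smul_eq_mul (poissonKernel 0 _ z)]
        rw [circleAverage_fun_smul, circleAverage_comp_mul_right (fun z => ‖f z‖ ^ p), hz',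
          smul_eq_mul, smul_eq_mul, mul_comm]
    _ = circleAverage (fun z => ‖f z‖ ^ p) 0 R := by
        rw [circleAverage_fun_smul, circleAverage_poissonKernel hw, smul_eq_mul, mul_one]

end Subharmonicity

theorem sq_mem_slitPlane_of_re_pos {u : ℂ} (hu : 0 < u.re) : u ^ 2 ∈ slitPlane := by
  rw [mem_slitPlane_iff, pow_two, mul_re, mul_im]
  by_cases him : u.im = 0
  · left
    rw [him, mul_zero, sub_zero]
    positivity
  · right
    have : u.re * u.im ≠ 0 := mul_ne_zero hu.ne' him
    contrapose! this
    linarith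

theorem one_sub_conj_mul_eq_mul_conj_sub (a : ℂ) {z : ℂ} (hz : ‖z‖ = 1) :
    1 - conj a * z = z * conj (z - a) := by
  have hzz : z * conj z = 1 := by rw [mul_conj', hz, ofReal_one, one_pow]
  rw [map_sub]
  linear_combination -hzz

theorem norm_one_sub_conj_mul (a : ℂ) {z : ℂ} (hz : ‖z‖ = 1) : ‖1 - conj a * z‖ = ‖z - a‖ := by
  rw [one_sub_conj_mul_eq_mul_conj_sub a hz, norm_mul, hz, one_mul, RCLike.norm_conj]

namespace DiscAut

variable (φ : DiscAut) {p : ℝ} {z : ℂ}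

section Basic

theorem re_one_sub_pos (hz : ‖z‖ ≤ 1) : 0 < (1 - conj (φ.a : ℂ) * z).re := by
  have h : ‖conj (φ.a : ℂ) * z‖ < 1 := by
    rw [norm_mul, RCLike.norm_conj]
    exact mul_lt_one_of_nonneg_of_lt_one_left (norm_nonneg _) φ.a.norm_lt_one hz
  rw [sub_re, one_re, sub_pos]
  exact (Complex.re_le_norm _).trans_lt h

theorem one_sub_ne_zero (hz : ‖z‖ ≤ 1) : 1 - conj (φ.a : ℂ) * z ≠ 0 := fun h => by
  simpa only [h, zero_re, lt_self_iff_false] using φ.re_one_sub_pos hz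

theorem one_sub_norm_sq_pos : 0 < 1 - ‖(φ.a : ℂ)‖ ^ 2 := sub_pos.mpr φ.a.sq_norm_lt_one

theorem conj_lam_mul_lam : conj (φ.lam : ℂ) * φ.lam = 1 := by
  rw [← normSq_eq_conj_mul_self, Circle.normSq_coe, ofReal_one]

theorem one_sub_norm_sq_toFun (hz : ‖z‖ ≤ 1) :
    1 - ‖φ.toFun z‖ ^ 2 =
      (1 - ‖(φ.a : ℂ)‖ ^ 2) * (1 - ‖z‖ ^ 2) / ‖1 - conj (φ.a : ℂ) * z‖ ^ 2 := by
  have hne : ‖1 - conj (φ.a : ℂ) * z‖ ^ 2 ≠ 0 :=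
    pow_ne_zero _ (norm_ne_zero_iff.mpr (φ.one_sub_ne_zero hz))
  have hpolar : ‖1 - conj (φ.a : ℂ) * z‖ ^ 2 - ‖z - (φ.a : ℂ)‖ ^ 2 =
      (1 - ‖(φ.a : ℂ)‖ ^ 2) * (1 - ‖z‖ ^ 2) := by
    simp only [← normSq_eq_norm_sq, normSq_apply, sub_re, sub_im, one_re, one_im, mul_re, mul_im,
      conj_re, conj_im]
    ring
  rw [toFun, norm_div, norm_mul, Circle.norm_coe, one_mul, div_pow, eq_div_iff hne, sub_mul,
    one_mul, div_mul_cancel₀ _ hne, hpolar]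

theorem norm_toFun_eq_one (hz : ‖z‖ = 1) : ‖φ.toFun z‖ = 1 := by
  have h := φ.one_sub_norm_sq_toFun hz.le
  rw [hz, one_pow, sub_self, mul_zero, zero_div, sub_eq_zero, eq_comm] at h
  exact (pow_eq_one_iff_of_nonneg (norm_nonneg _) two_ne_zero).mp h

theorem norm_toFun_le_one (hz : ‖z‖ ≤ 1) : ‖φ.toFun z‖ ≤ 1 := by
  rcases hz.lt_or_eq with h | h
  · exact (φ.norm_toFun_lt_one h).le
  · exact (φ.norm_toFun_eq_one h).le

theorem toFun_eq_zero_iff (hz : ‖z‖ ≤ 1) : φ.toFun z = 0 ↔ z = φ.a := by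
  rw [toFun, div_eq_zero_iff, or_iff_left (φ.one_sub_ne_zero hz), mul_eq_zero,
    or_iff_right (Circle.coe_ne_zero _), sub_eq_zero]

theorem coe_onDisc (z : UnitDisc) : (φ.onDisc z : ℂ) = φ.toFun z := UnitDisc.coe_mk _ _

theorem onDisc_eq_zero_iff (z : UnitDisc) : φ.onDisc z = 0 ↔ z = φ.a := by
  rw [← UnitDisc.coe_eq_zero, coe_onDisc, φ.toFun_eq_zero_iff z.norm_lt_one.le, UnitDisc.coe_inj]

end Basic

section Derivative

theorem hasDerivAt_toFun (hz : ‖z‖ ≤ 1) : HasDerivAt φ.toFun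
    (φ.lam * ((1 - ‖(φ.a : ℂ)‖ ^ 2 : ℝ) / (1 - conj (φ.a : ℂ) * z) ^ 2)) z := by
  have hne := φ.one_sub_ne_zero hz
  have h := (((hasDerivAt_id z).sub_const (φ.a : ℂ)).const_mul (φ.lam : ℂ)).div
    (((hasDerivAt_id z).const_mul (conj (φ.a : ℂ))).const_sub 1) hne
  refine HasDerivAt.congr_deriv (f := φ.toFun) h ?_
  rw [ofReal_sub, ofReal_one, ofReal_pow, ← conj_mul', ← mul_div_assoc]
  simp only [id]
  congr 1
  ring

theorem differentiableOn_toFun : DifferentiableOn ℂ φ.toFun (closedBall 0 1) := fun _ hz =>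
  (φ.hasDerivAt_toFun (mem_closedBall_zero_iff.mp hz)).differentiableAt.differentiableWithinAt

theorem conj_lam_mul_deriv (hz : ‖z‖ ≤ 1) : conj (φ.lam : ℂ) * deriv φ.toFun z =
    (1 - ‖(φ.a : ℂ)‖ ^ 2 : ℝ) / (1 - conj (φ.a : ℂ) * z) ^ 2 := by
  rw [(φ.hasDerivAt_toFun hz).deriv, ← mul_assoc, φ.conj_lam_mul_lam, one_mul]

theorem conj_lam_mul_deriv_mem_slitPlane (hz : ‖z‖ ≤ 1) :
    conj (φ.lam : ℂ) * deriv φ.toFun z ∈ slitPlane := by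
  have hinv : 0 < ((1 - conj (φ.a : ℂ) * z)⁻¹).re := by
    rw [inv_re]
    exact div_pos (φ.re_one_sub_pos hz) (normSq_pos.mpr (φ.one_sub_ne_zero hz))
  rw [φ.conj_lam_mul_deriv hz, div_eq_mul_inv, ← inv_pow]
  have := sq_mem_slitPlane_of_re_pos hinv
  rw [mem_slitPlane_iff] at this ⊢
  rw [re_ofReal_mul, im_ofReal_mul]
  exact this.imp (mul_pos φ.one_sub_norm_sq_pos) (mul_ne_zero φ.one_sub_norm_sq_pos.ne')

/-- The weight `(conj lam * φ')^(1/p)` of `U_φ`, as a function on the plane. -/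
noncomputable def weight (p : ℝ) (z : ℂ) : ℂ :=
  (conj (φ.lam : ℂ) * deriv φ.toFun z) ^ ((1 / p : ℝ) : ℂ)

theorem differentiableOn_weight (p : ℝ) : DifferentiableOn ℂ (φ.weight p) (closedBall 0 1) := by
  have hderiv : DifferentiableOn ℂ (fun z : ℂ => conj (φ.lam : ℂ) * deriv φ.toFun z)
      (closedBall 0 1) := by
    refine DifferentiableOn.congr (f := fun z => ((1 - ‖(φ.a : ℂ)‖ ^ 2 : ℝ) : ℂ) /
      (1 - conj (φ.a : ℂ) * z) ^ 2) ?_ fun z hz =>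
        φ.conj_lam_mul_deriv (mem_closedBall_zero_iff.mp hz)
    exact DifferentiableOn.div (by fun_prop) (by fun_prop)
      fun z hz => pow_ne_zero _ (φ.one_sub_ne_zero (mem_closedBall_zero_iff.mp hz))
  exact hderiv.cpow_const fun z hz =>
    φ.conj_lam_mul_deriv_mem_slitPlane (mem_closedBall_zero_iff.mp hz)

theorem weight_ne_zero (p : ℝ) (hz : ‖z‖ ≤ 1) : φ.weight p z ≠ 0 := by
  rw [weight, Ne, cpow_eq_zero_iff]
  exact fun h => slitPlane_ne_zero (φ.conj_lam_mul_deriv_mem_slitPlane hz) h.1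

theorem norm_weight_rpow (hp : p ≠ 0) : ‖φ.weight p z‖ ^ p = ‖deriv φ.toFun z‖ := by
  rw [weight, norm_cpow_real, ← rpow_mul (norm_nonneg _), one_div_mul_cancel hp, rpow_one,
    norm_mul, RCLike.norm_conj, Circle.norm_coe, one_mul]

end Derivative

section Inverse

/-- The inverse automorphism, in the parametrization by a unimodular factor and a zero. -/
noncomputable def inv : DiscAut where
  lam := φ.lam⁻¹
  a := -(φ.lam • φ.a)

theorem one_sub_conj_inv_a_mul_toFun (hz : ‖z‖ ≤ 1) : 1 - conj (φ.inv.a : ℂ) * φ.toFun z =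
    (1 - ‖(φ.a : ℂ)‖ ^ 2 : ℝ) / (1 - conj (φ.a : ℂ) * z) := by
  have hne := φ.one_sub_ne_zero hz
  rw [eq_div_iff hne, sub_mul, mul_assoc, toFun, div_mul_cancel₀ _ hne, inv, UnitDisc.coe_neg,
    UnitDisc.coe_circle_smul, map_neg, map_mul, ofReal_sub, ofReal_one, ofReal_pow, ← conj_mul']
  linear_combination conj (φ.a : ℂ) * (z - φ.a) * φ.conj_lam_mul_lam

theorem toFun_sub_inv_a (hz : ‖z‖ ≤ 1) : φ.toFun z - φ.inv.a =
    φ.lam * ((1 - ‖(φ.a : ℂ)‖ ^ 2 : ℝ) * z) / (1 - conj (φ.a : ℂ) * z) := by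
  have hne := φ.one_sub_ne_zero hz
  rw [eq_div_iff hne, sub_mul, toFun, div_mul_cancel₀ _ hne, inv, UnitDisc.coe_neg,
    UnitDisc.coe_circle_smul, ofReal_sub, ofReal_one, ofReal_pow, ← conj_mul']
  ring

theorem toFun_inv_toFun (hz : ‖z‖ ≤ 1) : φ.inv.toFun (φ.toFun z) = z := by
  have hne := φ.one_sub_ne_zero hz
  have ha : ((1 - ‖(φ.a : ℂ)‖ ^ 2 : ℝ) : ℂ) ≠ 0 := ofReal_ne_zero.mpr φ.one_sub_norm_sq_pos.ne'
  have hlam : ((φ.inv.lam : ℂ)) * φ.lam = 1 := by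
    rw [inv, Circle.coe_inv, inv_mul_cancel₀ (Circle.coe_ne_zero _)]
  rw [toFun, φ.one_sub_conj_inv_a_mul_toFun hz, φ.toFun_sub_inv_a hz, ← mul_div_assoc, ← mul_assoc,
    hlam, one_mul, div_div_div_cancel_right₀ hne, mul_div_cancel_left₀ _ ha]

theorem inv_inv : φ.inv.inv = φ := by
  obtain ⟨lam, a⟩ := φ
  simp only [inv, _root_.inv_inv, mk.injEq, true_and]
  rw [← UnitDisc.coe_inj]
  simp

theorem inv_onDisc_onDisc (z : UnitDisc) : φ.inv.onDisc (φ.onDisc z) = z := by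
  rw [← UnitDisc.coe_inj]
  exact φ.toFun_inv_toFun z.norm_lt_one.le

theorem onDisc_inv_onDisc (z : UnitDisc) : φ.onDisc (φ.inv.onDisc z) = z := by
  simpa only [inv_inv] using φ.inv.inv_onDisc_onDisc z

theorem norm_inv_a : ‖(φ.inv.a : ℂ)‖ = ‖(φ.a : ℂ)‖ := by
  rw [inv, UnitDisc.coe_neg, norm_neg, UnitDisc.coe_circle_smul, norm_mul, Circle.norm_coe, one_mul]

theorem weight_mul_weight_inv (p : ℝ) (hz : ‖z‖ ≤ 1) :
    φ.weight p z * φ.inv.weight p (φ.toFun z) = 1 := by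
  have ha : ((1 - ‖(φ.a : ℂ)‖ ^ 2 : ℝ) : ℂ) ≠ 0 := ofReal_ne_zero.mpr φ.one_sub_norm_sq_pos.ne'
  have hinv : conj (φ.inv.lam : ℂ) * deriv φ.inv.toFun (φ.toFun z) =
      (conj (φ.lam : ℂ) * deriv φ.toFun z)⁻¹ := by
    rw [φ.inv.conj_lam_mul_deriv (φ.norm_toFun_le_one hz), φ.one_sub_conj_inv_a_mul_toFun hz,
      φ.conj_lam_mul_deriv hz, norm_inv_a]
    field_simp
  rw [weight, weight, hinv,
    inv_cpow _ _ (slitPlane_arg_ne_pi (φ.conj_lam_mul_deriv_mem_slitPlane hz))]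
  exact mul_inv_cancel₀ (φ.weight_ne_zero p hz)

theorem onDisc_iterate_eq_zero_iff (ψ : DiscAut) (n : ℕ) (z : UnitDisc) :
    ψ.onDisc (φ.onDisc^[n] z) = 0 ↔ z = φ.inv.onDisc^[n] ψ.a := by
  have hl : Function.LeftInverse φ.inv.onDisc^[n] φ.onDisc^[n] :=
    Function.LeftInverse.iterate φ.inv_onDisc_onDisc n
  have hr : Function.RightInverse φ.inv.onDisc^[n] φ.onDisc^[n] :=
    Function.LeftInverse.iterate φ.onDisc_inv_onDisc n
  rw [onDisc_eq_zero_iff]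
  exact ⟨fun h => by rw [← h, hl], fun h => by rw [h, hr]⟩

end Inverse

section ChangeOfVariables

theorem norm_deriv_toFun (hz : ‖z‖ = 1) : ‖deriv φ.toFun z‖ = poissonKernel 0 φ.a z := by
  rw [(φ.hasDerivAt_toFun hz.le).deriv, norm_mul, Circle.norm_coe, one_mul, norm_div, norm_pow,
    norm_real, Real.norm_of_nonneg φ.one_sub_norm_sq_pos.le, norm_one_sub_conj_mul _ hz,
    poissonKernel_def, sub_zero, sub_zero, hz, one_pow]

theorem mul_deriv_toFun (hz : ‖z‖ = 1) :
    z * deriv φ.toFun z = ‖deriv φ.toFun z‖ * φ.toFun z := by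
  have h := one_sub_conj_mul_eq_mul_conj_sub φ.a hz
  have hne : z * conj (z - φ.a : ℂ) ≠ 0 := h ▸ φ.one_sub_ne_zero hz.le
  have hz0 : z ≠ 0 := left_ne_zero_of_mul hne
  have hza' : conj (z - φ.a : ℂ) ≠ 0 := right_ne_zero_of_mul hne
  have hza : z - φ.a ≠ 0 := (map_ne_zero _).mp hza'
  rw [φ.norm_deriv_toFun hz, poissonKernel_def, sub_zero, sub_zero, hz, one_pow,
    (φ.hasDerivAt_toFun hz.le).deriv, toFun, ofReal_div, ofReal_pow ‖_‖, ← mul_conj', h]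
  field_simp

theorem a_mem_ball : (φ.a : ℂ) ∈ ball 0 1 := mem_ball_zero_iff.mpr φ.a.norm_lt_one

theorem norm_deriv_toFun_circleMap (θ : ℝ) :
    ‖deriv φ.toFun (circleMap 0 1 θ)‖ = poissonKernel 0 φ.a (circleMap 0 1 θ) :=
  φ.norm_deriv_toFun (by rw [norm_circleMap_zero, abs_one])

theorem continuous_norm_deriv_circleMap :
    Continuous fun θ => ‖deriv φ.toFun (circleMap 0 1 θ)‖ := by
  simp only [norm_deriv_toFun_circleMap]
  exact (continuousOn_poissonKernel_sphere φ.a_mem_ball).comp_continuous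
    (continuous_circleMap 0 1) fun θ => circleMap_mem_sphere' 0 1 θ

/-- The lift of `φ` on the unit circle to a map of angles, obtained by integrating `|φ'|`. -/
noncomputable def angularLift (θ : ℝ) : ℝ :=
  arg (φ.toFun 1) + ∫ t in 0..θ, ‖deriv φ.toFun (circleMap 0 1 t)‖

theorem hasDerivAt_angularLift (θ : ℝ) :
    HasDerivAt φ.angularLift ‖deriv φ.toFun (circleMap 0 1 θ)‖ θ :=
  have hK := φ.continuous_norm_deriv_circleMap
  (intervalIntegral.integral_hasDerivAt_right (hK.intervalIntegrable _ _)
    hK.stronglyMeasurable.stronglyMeasurableAtFilter hK.continuousAt).const_add _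

theorem circleMap_angularLift_zero : circleMap 0 1 (φ.angularLift 0) = φ.toFun 1 := by
  have h := norm_mul_exp_arg_mul_I (φ.toFun 1)
  rw [φ.norm_toFun_eq_one norm_one] at h
  rw [angularLift, intervalIntegral.integral_same, add_zero, circleMap, zero_add, h]

theorem angularLift_two_pi : φ.angularLift (2 * π) = φ.angularLift 0 + 2 * π := by
  have h := circleAverage_poissonKernel φ.a_mem_ball
  rw [circleAverage_def, smul_eq_mul, inv_mul_eq_one₀ two_pi_pos.ne'] at h
  simp only [angularLift, intervalIntegral.integral_same, add_zero,
    norm_deriv_toFun_circleMap, ← h]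

theorem toFun_circleMap (θ : ℝ) :
    φ.toFun (circleMap 0 1 θ) = circleMap 0 1 (φ.angularLift θ) := by
  have hderiv (θ : ℝ) : HasDerivAt
      (fun θ => φ.toFun (circleMap 0 1 θ) * cexp (-(φ.angularLift θ * I))) 0 θ := by
    have hz : ‖circleMap 0 1 θ‖ = 1 := by rw [norm_circleMap_zero, abs_one]
    have h₁ : HasDerivAt (fun θ => φ.toFun (circleMap 0 1 θ))
        (deriv φ.toFun (circleMap 0 1 θ) * (circleMap 0 1 θ * I)) θ :=
      (φ.hasDerivAt_toFun hz.le).differentiableAt.hasDerivAt.comp θ (hasDerivAt_circleMap 0 1 θ)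
    have h₂ := (((φ.hasDerivAt_angularLift θ).ofReal_comp.mul_const I).neg).cexp
    refine (h₁.mul h₂).congr_deriv ?_
    linear_combination (I * cexp (-(φ.angularLift θ * I))) * φ.mul_deriv_toFun hz
  have hconst := is_const_of_deriv_eq_zero (fun θ => (hderiv θ).differentiableAt)
    (fun θ => (hderiv θ).deriv) θ 0
  rw [show circleMap 0 1 0 = 1 by simp [circleMap], ← φ.circleMap_angularLift_zero] at hconst
  simpa [circleMap, Complex.exp_neg, mul_inv_eq_one₀ (Complex.exp_ne_zero _)] using hconst

theorem circleAverage_norm_deriv_mul_comp {h : ℂ → ℝ} (hh : ContinuousOn h (sphere 0 1)) :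
    circleAverage (fun z => ‖deriv φ.toFun z‖ * h (φ.toFun z)) 0 1 = circleAverage h 0 1 := by
  set k : ℝ → ℝ := fun θ => h (circleMap 0 1 θ) with hk
  have hcont : Continuous k := hh.comp_continuous (continuous_circleMap 0 1)
    fun θ => circleMap_mem_sphere 0 zero_le_one θ
  have hper : Function.Periodic k (2 * π) := (periodic_circleMap 0 1).comp h
  calc circleAverage (fun z => ‖deriv φ.toFun z‖ * h (φ.toFun z)) 0 1
      = (2 * π)⁻¹ * ∫ θ in 0..2 * π,
          (k ∘ φ.angularLift) θ * ‖deriv φ.toFun (circleMap 0 1 θ)‖ := by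
        simp only [circleAverage_def, smul_eq_mul, toFun_circleMap, Function.comp_apply, hk,
          mul_comm]
    _ = (2 * π)⁻¹ * ∫ θ in φ.angularLift 0..φ.angularLift (2 * π), k θ := by
        rw [intervalIntegral.integral_comp_mul_deriv (fun θ _ => φ.hasDerivAt_angularLift θ)
          φ.continuous_norm_deriv_circleMap.continuousOn hcont]
    _ = circleAverage h 0 1 := by
        rw [angularLift_two_pi, hper.intervalIntegral_add_eq _ 0, zero_add, circleAverage_def,
          smul_eq_mul]

end ChangeOfVariables

end DiscAut

section Means

variable {p : ℝ} {f g : UnitDisc → ℂ}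

theorem extend_eqOn {G : ℂ → ℂ} (h : ∀ z : UnitDisc, f z = G z) :
    EqOn (extend f) G (ball 0 1) := fun z hz => by
  have hf := extend_apply f (UnitDisc.mk z (mem_ball_zero_iff.mp hz))
  rwa [h, UnitDisc.coe_mk] at hf

theorem sphere_abs_subset_ball {r : ℝ} (hr : r ∈ Ioo (0 : ℝ) 1) :
    sphere (0 : ℂ) |r| ⊆ ball 0 1 := by
  rw [abs_of_pos hr.1]
  exact sphere_subset_closedBall.trans (closedBall_subset_ball hr.2)

theorem pMean_eq_circleAverage {G : ℂ → ℂ} (h : ∀ z : UnitDisc, f z = G z) {r : ℝ}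
    (hr : r ∈ Ioo (0 : ℝ) 1) : pMean p f r = circleAverage (fun z => ‖G z‖ ^ p) 0 r :=
  circleAverage_congr_sphere fun z hz => by
    simp only [extend_eqOn h (sphere_abs_subset_ball hr hz)]

theorem pMean_mono (hp : 1 ≤ p) (hf : DifferentiableOn ℂ (extend f) (ball 0 1)) {s r : ℝ}
    (hs : 0 ≤ s) (hsr : s ≤ r) (hr : r < 1) : pMean p f s ≤ pMean p f r := by
  rcases hsr.eq_or_lt with rfl | hlt
  · rfl
  · refine circleAverage_norm_rpow_le hp (DifferentiableOn.diffContOnCl ?_) hs hlt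
    exact hf.mono (closure_ball_subset_closedBall.trans (closedBall_subset_ball hr))

/-- The upper bounds of the integral means of `f`. They determine both whether an analytic `f`
lies in `H^p` and its norm. -/
def pMeanBounds (p : ℝ) (f : UnitDisc → ℂ) : Set ℝ :=
  upperBounds (pMean p f '' Ioo (0 : ℝ) 1)

theorem mem_pMeanBounds {B : ℝ} :
    B ∈ pMeanBounds p f ↔ ∀ r ∈ Ioo (0 : ℝ) 1, pMean p f r ≤ B :=
  forall_mem_image

theorem mem_hardySpace_iff (hp : 1 ≤ p) : f ∈ hardySpace p hp ↔
    DifferentiableOn ℂ (extend f) (ball 0 1) ∧ (pMeanBounds p f).Nonempty :=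
  Iff.rfl

theorem hardyNorm_congr (h : pMeanBounds p f = pMeanBounds p g)
    (hf : (pMeanBounds p f).Nonempty) : hardyNorm p f = hardyNorm p g := by
  have hne (k : UnitDisc → ℂ) : (pMean p k '' Ioo (0 : ℝ) 1).Nonempty :=
    (nonempty_Ioo.mpr one_pos).image _
  have hg : (pMeanBounds p g).Nonempty := h ▸ hf
  have hlubf : IsLeast (pMeanBounds p f) _ := isLUB_csSup (hne f) hf
  have hlubg : IsLeast (pMeanBounds p g) _ := isLUB_csSup (hne g) hg
  rw [hardyNorm, hardyNorm, hlubf.unique (h ▸ hlubg)]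

theorem mem_hardySpace_of_bounded (hp : 1 ≤ p) (hf : DifferentiableOn ℂ (extend f) (ball 0 1))
    {C : ℝ} (hC : ∀ z, ‖f z‖ ≤ C) : f ∈ hardySpace p hp := by
  refine ⟨hf, C ^ p, mem_pMeanBounds.mpr fun r hr => ?_⟩
  refine circleAverage_mono_on_of_le_circle
    (circleIntegrable_norm_rpow hp hf.continuousOn hr) fun z hz => ?_
  have hz' : ‖z‖ < 1 := mem_ball_zero_iff.mp (sphere_abs_subset_ball hr hz)
  rw [← UnitDisc.coe_mk z hz', extend_apply]
  exact rpow_le_rpow (norm_nonneg _) (hC _) (by linarith)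

end Means

section InnerMultiplier

variable {p : ℝ} {f : UnitDisc → ℂ} {K : ℂ → ℂ}

theorem mulOp_apply_eq_mul_extend (K : ℂ → ℂ) (f : UnitDisc → ℂ) (z : UnitDisc) :
    mulOp (fun z => K z) f z = K z * extend f z :=
  congrArg (K z * ·) (extend_apply f z).symm

theorem differentiableOn_mulOp (hK : DifferentiableOn ℂ K (ball 0 1))
    (hf : DifferentiableOn ℂ (extend f) (ball 0 1)) :
    DifferentiableOn ℂ (extend (mulOp (fun z => K z) f)) (ball 0 1) :=
  (hK.mul hf).congr (extend_eqOn (mulOp_apply_eq_mul_extend K f))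

theorem pMean_mulOp_le (hp : 1 ≤ p) (hK : ContinuousOn K (ball 0 1))
    (hK1 : ∀ z ∈ ball 0 1, ‖K z‖ ≤ 1) (hf : ContinuousOn (extend f) (ball 0 1)) {r : ℝ}
    (hr : r ∈ Ioo (0 : ℝ) 1) : pMean p (mulOp (fun z => K z) f) r ≤ pMean p f r := by
  rw [pMean_eq_circleAverage (G := fun z => K z * extend f z) (mulOp_apply_eq_mul_extend K f) hr]
  refine circleAverage_mono (circleIntegrable_norm_rpow hp (hK.mul hf) hr)
    (circleIntegrable_norm_rpow hp hf hr) fun z hz => ?_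
  rw [norm_mul]
  have := hK1 z (sphere_abs_subset_ball hr hz)
  gcongr
  exact mul_le_of_le_one_left (norm_nonneg _) this

theorem rpow_mul_pMean_le_pMean_mulOp (hp : 1 ≤ p) (hK : ContinuousOn K (ball 0 1))
    (hf : ContinuousOn (extend f) (ball 0 1)) {r c : ℝ} (hr : r ∈ Ioo (0 : ℝ) 1) (hc : 0 ≤ c)
    (hcK : ∀ z, ‖z‖ = r → c ≤ ‖K z‖) :
    c ^ p * pMean p f r ≤ pMean p (mulOp (fun z => K z) f) r := by
  rw [pMean_eq_circleAverage (G := fun z => K z * extend f z) (mulOp_apply_eq_mul_extend K f) hr,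
    pMean, ← smul_eq_mul, ← circleAverage_smul]
  refine circleAverage_mono (circleIntegrable_norm_rpow hp hf hr).const_smul
    (circleIntegrable_norm_rpow hp (hK.mul hf) hr) fun z hz => ?_
  rw [Pi.smul_apply, smul_eq_mul, norm_mul, mul_rpow (norm_nonneg _) (norm_nonneg _)]
  have := hcK z (by rwa [mem_sphere_zero_iff_norm, abs_of_pos hr.1] at hz)
  gcongr

theorem eventually_forall_norm_eq_lt_norm (hK : ContinuousOn K (closedBall 0 1))
    (hK1 : ∀ z, ‖z‖ = 1 → ‖K z‖ = 1) {c : ℝ} (hc : c < 1) :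
    ∀ᶠ r in 𝓝[<] (1 : ℝ), ∀ z, ‖z‖ = r → c < ‖K z‖ := by
  set S : Set ℂ := closedBall 0 1 ∩ (fun z => ‖K z‖) ⁻¹' Iic c
  have hScpt : IsCompact S := (isCompact_closedBall 0 1).of_isClosed_subset
    (hK.norm.preimage_isClosed_of_isClosed isClosed_closedBall isClosed_Iic) inter_subset_left
  have hSnorm : (1 : ℝ) ∉ norm '' S := by
    rintro ⟨z, hz, hz1⟩
    have : ‖K z‖ ≤ c := hz.2
    linarith [hK1 z hz1]
  filter_upwards [self_mem_nhdsWithin, nhdsWithin_le_nhds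
    ((hScpt.image continuous_norm).isClosed.isOpen_compl.mem_nhds hSnorm)] with r hr1 hrS z hz
  by_contra! hle
  exact hrS ⟨z, ⟨mem_closedBall_zero_iff.mpr (hz.trans_lt hr1).le, hle⟩, hz⟩

theorem pMeanBounds_mulOp (hp : 1 ≤ p) (hK : ContinuousOn K (closedBall 0 1))
    (hKle : ∀ z ∈ ball 0 1, ‖K z‖ ≤ 1) (hK1 : ∀ z, ‖z‖ = 1 → ‖K z‖ = 1)
    (hf : DifferentiableOn ℂ (extend f) (ball 0 1)) :
    pMeanBounds p (mulOp (fun z => K z) f) = pMeanBounds p f := by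
  have hKball := hK.mono ball_subset_closedBall
  ext B
  simp only [mem_pMeanBounds]
  refine ⟨fun hB r hr => ?_, fun hB r hr =>
    (pMean_mulOp_le hp hKball hKle hf.continuousOn hr).trans (hB r hr)⟩
  have hlt (c : ℝ) (hc : c ∈ Ioo (0 : ℝ) 1) : c ^ p * pMean p f r ≤ B := by
    obtain ⟨t, hcK, hrt, ht1⟩ := ((eventually_forall_norm_eq_lt_norm hK hK1 hc.2).and
      (Ioo_mem_nhdsLT hr.2)).exists
    have ht : t ∈ Ioo (0 : ℝ) 1 := ⟨hr.1.trans hrt, ht1⟩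
    calc c ^ p * pMean p f r ≤ c ^ p * pMean p f t :=
          mul_le_mul_of_nonneg_left (pMean_mono hp hf hr.1.le hrt.le ht1) (rpow_nonneg hc.1.le p)
      _ ≤ pMean p (mulOp (fun z => K z) f) t :=
          rpow_mul_pMean_le_pMean_mulOp hp hKball hf.continuousOn ht hc.1.le
            fun z hz => (hcK z hz).le
      _ ≤ B := hB t ht
  have hlim : Tendsto (fun c : ℝ => c ^ p * pMean p f r) (𝓝[<] 1) (𝓝 (1 ^ p * pMean p f r)) :=
    (((continuousAt_id.rpow_const (Or.inl one_ne_zero)).mul_const _).tendsto).mono_left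
      nhdsWithin_le_nhds
  rw [one_rpow, one_mul] at hlim
  exact le_of_tendsto hlim (eventually_of_mem (Ioo_mem_nhdsLT one_pos) hlt)

end InnerMultiplier

section MulAut

variable {p : ℝ} (ψ : DiscAut) {f : UnitDisc → ℂ}

/-- The operator `M_ψ` of multiplication by a disc automorphism. -/
noncomputable abbrev mulAut : Module.End ℂ (UnitDisc → ℂ) :=
  mulOp fun z => (ψ.onDisc z : ℂ)

theorem mulAut_apply (z : UnitDisc) : mulAut ψ f z = ψ.toFun z * f z := rfl

theorem differentiableOn_mulAut (hf : DifferentiableOn ℂ (extend f) (ball 0 1)) :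
    DifferentiableOn ℂ (extend (mulAut ψ f)) (ball 0 1) :=
  differentiableOn_mulOp (K := ψ.toFun) (ψ.differentiableOn_toFun.mono ball_subset_closedBall) hf

theorem pMeanBounds_mulAut (hp : 1 ≤ p) (hf : DifferentiableOn ℂ (extend f) (ball 0 1)) :
    pMeanBounds p (mulAut ψ f) = pMeanBounds p f :=
  pMeanBounds_mulOp (K := ψ.toFun) hp ψ.differentiableOn_toFun.continuousOn
    (fun _ hz => ψ.norm_toFun_le_one (mem_ball_zero_iff.mp hz).le)
    (fun _ => ψ.norm_toFun_eq_one) hf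

theorem mulAut_mem_hardySpace_iff (hp : 1 ≤ p) (hf : DifferentiableOn ℂ (extend f) (ball 0 1)) :
    mulAut ψ f ∈ hardySpace p hp ↔ f ∈ hardySpace p hp := by
  simp only [mem_hardySpace_iff, pMeanBounds_mulAut ψ hp hf, hf, differentiableOn_mulAut ψ hf]

theorem exists_mulAut_eq (hp : 1 ≤ p) (hf : f ∈ hardySpace p hp) (h0 : f ψ.a = 0) :
    ∃ g ∈ hardySpace p hp, mulAut ψ g = f := by
  set d := dslope (extend f) ψ.a
  have hddiff : DifferentiableOn ℂ d (ball 0 1) :=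
    (differentiableOn_dslope (isOpen_ball.mem_nhds ψ.a_mem_ball)).mpr hf.1
  set G : ℂ → ℂ := fun z => conj (ψ.lam : ℂ) * (1 - conj (ψ.a : ℂ) * z) * d z with hG
  set g : UnitDisc → ℂ := fun z => G z with hg
  have hgdiff : DifferentiableOn ℂ (extend g) (ball 0 1) :=
    DifferentiableOn.congr (f := G) (by fun_prop) (extend_eqOn fun _ => rfl)
  have hψg : mulAut ψ g = f := by
    ext z
    have hslope : ((z : ℂ) - ψ.a) * d z = f z := by
      have := sub_smul_dslope (extend f) (ψ.a : ℂ) (z : ℂ)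
      rwa [extend_apply, extend_apply, h0, sub_zero, smul_eq_mul] at this
    rw [mulAut_apply, ← hslope, hg, hG, DiscAut.toFun, div_mul_eq_mul_div,
      div_eq_iff (ψ.one_sub_ne_zero z.norm_lt_one.le)]
    linear_combination
      ((z : ℂ) - ψ.a) * (1 - conj (ψ.a : ℂ) * z) * d z * ψ.conj_lam_mul_lam
  refine ⟨g, ?_, hψg⟩
  rwa [← mulAut_mem_hardySpace_iff ψ hp hgdiff, hψg]

end MulAut

section WeightedCompOp

variable {p : ℝ} (φ : DiscAut) {f : UnitDisc → ℂ}

theorem weightedCompOp_apply (f : UnitDisc → ℂ) (z : UnitDisc) :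
    weightedCompOp p φ f z = φ.weight p z * f (φ.onDisc z) := rfl

theorem weightedCompOp_apply_eq_mul_extend (f : UnitDisc → ℂ) (z : UnitDisc) :
    weightedCompOp p φ f z = φ.weight p z * extend f (φ.toFun z) := by
  rw [weightedCompOp_apply, ← extend_apply f, DiscAut.coe_onDisc]

theorem weightedCompOp_weightedCompOp_inv (f : UnitDisc → ℂ) :
    weightedCompOp p φ (weightedCompOp p φ.inv f) = f := by
  ext z
  rw [weightedCompOp_apply, weightedCompOp_apply, DiscAut.inv_onDisc_onDisc, ← mul_assoc,
    DiscAut.coe_onDisc, φ.weight_mul_weight_inv p z.norm_lt_one.le, one_mul]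

theorem weightedCompOp_inv_weightedCompOp (f : UnitDisc → ℂ) :
    weightedCompOp p φ.inv (weightedCompOp p φ f) = f := by
  simpa only [DiscAut.inv_inv] using weightedCompOp_weightedCompOp_inv (p := p) φ.inv f

theorem differentiableOn_weightedCompOp (hf : DifferentiableOn ℂ (extend f) (ball 0 1)) :
    DifferentiableOn ℂ (extend (weightedCompOp p φ f)) (ball 0 1) := by
  refine DifferentiableOn.congr (f := fun z => φ.weight p z * extend f (φ.toFun z)) ?_
    (extend_eqOn (weightedCompOp_apply_eq_mul_extend φ f))
  refine ((φ.differentiableOn_weight p).mono ball_subset_closedBall).mul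
    (hf.comp (φ.differentiableOn_toFun.mono ball_subset_closedBall) fun z hz => ?_)
  rw [mem_ball_zero_iff] at hz ⊢
  exact φ.norm_toFun_lt_one hz

theorem circleAverage_norm_weight_mul_comp_le (hp : 1 ≤ p) {G : ℂ → ℂ}
    (hG : DifferentiableOn ℂ G (closedBall 0 1)) {s : ℝ} (hs : s ∈ Ioo (0 : ℝ) 1) :
    circleAverage (fun z => ‖φ.weight p z * G (φ.toFun z)‖ ^ p) 0 s ≤
      circleAverage (fun z => ‖G z‖ ^ p) 0 1 := by
  have hp0 : 0 < p := by linarith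
  have hdiff : DiffContOnCl ℂ (fun z => φ.weight p z * G (φ.toFun z)) (ball 0 1) := by
    refine DifferentiableOn.diffContOnCl ?_
    rw [closure_ball _ one_ne_zero]
    refine (φ.differentiableOn_weight p).mul (hG.comp φ.differentiableOn_toFun fun z hz => ?_)
    rw [mem_closedBall_zero_iff] at hz ⊢
    exact φ.norm_toFun_le_one hz
  calc circleAverage (fun z => ‖φ.weight p z * G (φ.toFun z)‖ ^ p) 0 s
      ≤ circleAverage (fun z => ‖φ.weight p z * G (φ.toFun z)‖ ^ p) 0 1 :=
        circleAverage_norm_rpow_le hp hdiff hs.1.le hs.2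
    _ = circleAverage (fun z => ‖deriv φ.toFun z‖ * ‖G (φ.toFun z)‖ ^ p) 0 1 := by
        simp only [norm_mul, mul_rpow (norm_nonneg _) (norm_nonneg _), φ.norm_weight_rpow hp0.ne']
    _ = circleAverage (fun z => ‖G z‖ ^ p) 0 1 :=
        φ.circleAverage_norm_deriv_mul_comp (h := fun z => ‖G z‖ ^ p)
          ((hG.continuousOn.mono sphere_subset_closedBall).norm.rpow_const
            fun _ _ => Or.inr hp0.le)

-- `f` need not extend to the circle, so the change of variables is applied to its dilations.
theorem circleAverage_norm_weight_mul_dilation_le (hp : 1 ≤ p)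
    (hf : DifferentiableOn ℂ (extend f) (ball 0 1)) {s ρ : ℝ} (hs : s ∈ Ioo (0 : ℝ) 1)
    (hρ : ρ ∈ Ioo (0 : ℝ) 1) :
    circleAverage (fun z => ‖φ.weight p z * extend f (φ.toFun z * ρ)‖ ^ p) 0 s ≤ pMean p f ρ := by
  have hG : DifferentiableOn ℂ (fun z => extend f (z * ρ)) (closedBall 0 1) :=
    hf.comp (by fun_prop) fun z hz => by
      rw [mem_closedBall_zero_iff] at hz
      rw [mem_ball_zero_iff, norm_mul, norm_real, Real.norm_of_nonneg hρ.1.le]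
      exact mul_lt_one_of_nonneg_of_lt_one_right hz hρ.1.le hρ.2
  refine (circleAverage_norm_weight_mul_comp_le φ hp hG hs).trans_eq ?_
  rw [circleAverage_comp_mul_right (fun z => ‖extend f z‖ ^ p), norm_real,
    Real.norm_of_nonneg hρ.1.le, pMean]

theorem continuousOn_circleAverage_norm_weight_mul_dilation (hp : 0 ≤ p)
    (hf : ContinuousOn (extend f) (ball 0 1)) {s : ℝ} (hs : s ∈ Ioo (0 : ℝ) 1) :
    ContinuousOn (fun ρ : ℝ =>
      circleAverage (fun z => ‖φ.weight p z * extend f (φ.toFun z * ρ)‖ ^ p) 0 s) (Icc 0 1) := by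
  have hball (x : ℝ × ℂ) (hx : x ∈ Icc (0 : ℝ) 1 ×ˢ sphere (0 : ℂ) |s|) : x.2 ∈ ball (0 : ℂ) 1 :=
    sphere_abs_subset_ball hs hx.2
  have hsnd : MapsTo Prod.snd (Icc (0 : ℝ) 1 ×ˢ sphere (0 : ℂ) |s|) (closedBall (0 : ℂ) 1) :=
    fun x hx => ball_subset_closedBall (hball x hx)
  have hweight := (φ.differentiableOn_weight p).continuousOn.comp continuousOn_snd hsnd
  have htoFun := φ.differentiableOn_toFun.continuousOn.comp continuousOn_snd hsnd
  have hdil : ContinuousOn (fun x : ℝ × ℂ => extend f (φ.toFun x.2 * x.1))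
      (Icc (0 : ℝ) 1 ×ˢ sphere (0 : ℂ) |s|) := by
    refine hf.comp (htoFun.mul (by fun_prop)) fun x hx => ?_
    rw [mem_ball_zero_iff, norm_mul, norm_real, Real.norm_of_nonneg hx.1.1]
    exact mul_lt_one_of_nonneg_of_lt_one_left (norm_nonneg _)
      (φ.norm_toFun_lt_one (mem_ball_zero_iff.mp (hball x hx))) hx.1.2
  exact continuousOn_circleAverage
    (F := fun (ρ : ℝ) z => ‖φ.weight p z * extend f (φ.toFun z * ρ)‖ ^ p)
    ((hweight.mul hdil).norm.rpow_const fun _ _ => Or.inr hp)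

theorem pMeanBounds_subset_weightedCompOp (hp : 1 ≤ p)
    (hf : DifferentiableOn ℂ (extend f) (ball 0 1)) :
    pMeanBounds p f ⊆ pMeanBounds p (weightedCompOp p φ f) := by
  intro B hB
  rw [mem_pMeanBounds] at hB ⊢
  intro s hs
  set k : ℝ → ℝ := fun ρ =>
    circleAverage (fun z => ‖φ.weight p z * extend f (φ.toFun z * ρ)‖ ^ p) 0 s with hk
  have hk1 : pMean p (weightedCompOp p φ f) s = k 1 := by
    rw [pMean_eq_circleAverage (G := fun z => φ.weight p z * extend f (φ.toFun z))
      (weightedCompOp_apply_eq_mul_extend φ f) hs]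
    simp only [hk, ofReal_one, mul_one]
  have hlim : Tendsto k (𝓝[<] 1) (𝓝 (k 1)) :=
    ((continuousOn_circleAverage_norm_weight_mul_dilation φ (zero_le_one.trans hp)
      hf.continuousOn hs).continuousWithinAt (right_mem_Icc.mpr zero_le_one)).mono_left
        (nhdsWithin_le_of_mem (Icc_mem_nhdsLT one_pos))
  rw [hk1]
  refine le_of_tendsto hlim (eventually_of_mem (Ioo_mem_nhdsLT one_pos) fun ρ hρ => ?_)
  exact (circleAverage_norm_weight_mul_dilation_le φ hp hf hs hρ).trans (hB ρ hρ)

theorem pMeanBounds_weightedCompOp (hp : 1 ≤ p) (hf : DifferentiableOn ℂ (extend f) (ball 0 1)) :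
    pMeanBounds p (weightedCompOp p φ f) = pMeanBounds p f := by
  refine Subset.antisymm ?_ (pMeanBounds_subset_weightedCompOp φ hp hf)
  simpa only [weightedCompOp_inv_weightedCompOp] using
    pMeanBounds_subset_weightedCompOp φ.inv hp (differentiableOn_weightedCompOp (p := p) φ hf)

theorem weightedCompOp_mem_hardySpace (hp : 1 ≤ p) (hf : f ∈ hardySpace p hp) :
    weightedCompOp p φ f ∈ hardySpace p hp := by
  rw [mem_hardySpace_iff] at hf ⊢
  rw [pMeanBounds_weightedCompOp φ hp hf.1]
  exact ⟨differentiableOn_weightedCompOp φ hf.1, hf.2⟩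

end WeightedCompOp

section CodimOne

variable {p : ℝ} (φ ψ : DiscAut) {f : UnitDisc → ℂ}

theorem mulAut_mul_weightedCompOp_apply_eq_zero_iff {z : UnitDisc} :
    (mulAut ψ * weightedCompOp p φ) f z = 0 ↔ z = ψ.a ∨ f (φ.onDisc z) = 0 := by
  rw [Module.End.mul_apply, mulAut_apply, weightedCompOp_apply, mul_eq_zero, mul_eq_zero,
    ψ.toFun_eq_zero_iff z.norm_lt_one.le, UnitDisc.coe_inj,
    or_iff_right (φ.weight_ne_zero p z.norm_lt_one.le)]

theorem mem_map_mulAut_mul_weightedCompOp (hp : 1 ≤ p) :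
    f ∈ (hardySpace p hp).map (mulAut ψ * weightedCompOp p φ) ↔
      f ∈ hardySpace p hp ∧ f ψ.a = 0 := by
  constructor
  · rintro ⟨g, hg, rfl⟩
    have hU := weightedCompOp_mem_hardySpace φ hp hg
    exact ⟨(mulAut_mem_hardySpace_iff ψ hp hU.1).mpr hU,
      (mulAut_mul_weightedCompOp_apply_eq_zero_iff φ ψ).mpr (Or.inl rfl)⟩
  · rintro ⟨hf, h0⟩
    obtain ⟨g, hg, rfl⟩ := exists_mulAut_eq ψ hp hf h0
    exact ⟨weightedCompOp p φ.inv g, weightedCompOp_mem_hardySpace φ.inv hp hg, by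
      rw [Module.End.mul_apply, weightedCompOp_weightedCompOp_inv]⟩

theorem finrank_quotient_eq_one_of_mem_iff {hp : 1 ≤ p} {V : Submodule ℂ (UnitDisc → ℂ)}
    {c : UnitDisc} (hV : ∀ f, f ∈ V ↔ f ∈ hardySpace p hp ∧ f c = 0) :
    Module.finrank ℂ (hardySpace p hp ⧸ V.submoduleOf (hardySpace p hp)) = 1 := by
  let ev : hardySpace p hp →ₗ[ℂ] ℂ := LinearMap.proj c ∘ₗ (hardySpace p hp).subtype
  have hev : Function.Surjective ev := fun w => by
    refine ⟨⟨fun _ => w, mem_hardySpace_of_bounded hp ?_ (fun _ => le_rfl)⟩, rfl⟩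
    exact (differentiableOn_const w).congr (extend_eqOn fun _ => rfl)
  have hker : V.submoduleOf (hardySpace p hp) = ev.ker := by
    ext f
    rw [LinearMap.mem_ker]
    exact (hV f).trans (and_iff_right f.2)
  rw [hker, (ev.quotKerEquivOfSurjective hev).finrank_eq, Module.finrank_self]

theorem isCodimOneIsometry_mulAut_mul_weightedCompOp (hp : 1 ≤ p) :
    IsCodimOneIsometry p hp (mulAut ψ * weightedCompOp p φ) where
  mapsTo f hf := ((mem_map_mulAut_mul_weightedCompOp φ ψ hp).mp ⟨f, hf, rfl⟩).1
  norm_map f hf := by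
    have hU := weightedCompOp_mem_hardySpace φ hp hf
    exact (hardyNorm_congr (pMeanBounds_mulAut ψ hp hU.1)
      ((mulAut_mem_hardySpace_iff ψ hp hU.1).mpr hU).2).trans
      (hardyNorm_congr (pMeanBounds_weightedCompOp φ hp hf.1) hU.2)
  codim := finrank_quotient_eq_one_of_mem_iff fun _ => mem_map_mulAut_mul_weightedCompOp φ ψ hp

end CodimOne

section Cayley

/-- The Cayley transform onto the upper half-plane sending the boundary point `w` to infinity, in
whose coordinate a parabolic automorphism fixing `w` is a translation. -/
noncomputable def cayley (w z : ℂ) : ℂ := I * (w + z) / (w - z)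

variable {w z : ℂ}

theorem sub_ne_zero_of_norm_lt (hz : ‖z‖ < ‖w‖) : w - z ≠ 0 :=
  sub_ne_zero.mpr fun h => hz.ne (congrArg norm h.symm)

theorem im_cayley (w z : ℂ) : (cayley w z).im = (‖w‖ ^ 2 - ‖z‖ ^ 2) / ‖w - z‖ ^ 2 := by
  have h := congrFun (poissonKernel_eq_re_herglotzRieszKernel (c := 0) (w := z)) w
  simp only [poissonKernel_def, Function.comp_apply, herglotzRieszKernel_def, sub_zero] at h
  rw [h, cayley, mul_div_assoc, I_mul_im]

theorem im_cayley_pos (hz : ‖z‖ < ‖w‖) : 0 < (cayley w z).im := by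
  rw [im_cayley]
  exact div_pos (sub_pos.mpr (pow_lt_pow_left₀ hz (norm_nonneg z) two_ne_zero))
    (pow_pos (norm_pos_iff.mpr (sub_ne_zero_of_norm_lt hz)) 2)

theorem cayley_add_I (hz : ‖z‖ < ‖w‖) : cayley w z + I = 2 * I * w / (w - z) := by
  have := sub_ne_zero_of_norm_lt hz
  rw [cayley]
  field_simp
  ring

theorem one_sub_norm_sq_eq_cayley (hw : ‖w‖ = 1) (hz : ‖z‖ < 1) :
    1 - ‖z‖ ^ 2 = 4 * (cayley w z).im * (‖cayley w z + I‖ ^ 2)⁻¹ := by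
  rw [← hw] at hz
  have hne : ‖w - z‖ ≠ 0 := norm_ne_zero_iff.mpr (sub_ne_zero_of_norm_lt hz)
  rw [im_cayley, cayley_add_I hz, norm_div, norm_mul, norm_mul, hw, norm_I, Complex.norm_ofNat]
  field_simp
  norm_num

theorem differentiableOn_cayley (w : ℂ) : DifferentiableOn ℂ (cayley w) (ball 0 ‖w‖) :=
  DifferentiableOn.div (by fun_prop) (by fun_prop)
    fun _ hz => sub_ne_zero_of_norm_lt (mem_ball_zero_iff.mp hz)

end Cayley

section Translation

variable {φ : DiscAut} {w : ℂ}

theorem DiscAut.toFun_eq_self_iff {z : ℂ} (hz : ‖z‖ ≤ 1) :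
    φ.toFun z = z ↔ conj (φ.a : ℂ) * z ^ 2 + (φ.lam - 1) * z - φ.lam * φ.a = 0 := by
  rw [toFun, div_eq_iff (φ.one_sub_ne_zero hz), ← sub_eq_zero]
  ring_nf

-- The fixed point equation `conj a * z² + (lam - 1) * z - lam * a = 0` has root product
-- `-lam * a / conj a` of modulus one, so its second root is again a fixed point on the circle.
theorem DiscAut.IsParabolic.exists_double_root (hφ : φ.IsParabolic) :
    ∃ w : ℂ, ‖w‖ = 1 ∧ conj (φ.a : ℂ) * w ≠ 0 ∧ conj (φ.a : ℂ) * w ^ 2 = -(φ.lam * φ.a) ∧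
      (φ.lam : ℂ) = 1 - 2 * (conj (φ.a : ℂ) * w) := by
  obtain ⟨w, hw, hfix, huniq⟩ := hφ
  have hw0 : w ≠ 0 := norm_ne_zero_iff.mp (hw ▸ one_ne_zero)
  have ha : (φ.a : ℂ) ≠ 0 := fun ha =>
    hw0 (huniq 0 (norm_zero.trans_le zero_le_one) (by rw [toFun, ha]; simp)).symm
  have hca : conj (φ.a : ℂ) ≠ 0 := (map_ne_zero _).mpr ha
  rw [toFun_eq_self_iff hw.le] at hfix
  obtain ⟨w', hprod⟩ : ∃ w', conj (φ.a : ℂ) * w * w' = -(φ.lam * φ.a) :=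
    ⟨_, mul_div_cancel₀ _ (mul_ne_zero hca hw0)⟩
  have hw' : ‖w'‖ = 1 := by
    have h := congrArg norm hprod
    rw [norm_mul, norm_mul, norm_neg, norm_mul, RCLike.norm_conj, hw, Circle.norm_coe, one_mul,
      mul_one] at h
    exact mul_eq_left₀ (norm_ne_zero_iff.mpr ha) |>.mp h
  have hsum : conj (φ.a : ℂ) * (w + w') = 1 - φ.lam := by
    apply mul_left_cancel₀ hw0
    linear_combination hprod + hfix
  have hww' : w' = w := by
    refine huniq w' hw'.le ((toFun_eq_self_iff hw'.le).mpr ?_)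
    linear_combination w' * hsum - hprod
  subst hww'
  refine ⟨w', hw, mul_ne_zero hca hw0, by linear_combination hprod, by linear_combination hsum⟩

theorem DiscAut.cayley_toFun (hw : ‖w‖ = 1) (hroot : conj (φ.a : ℂ) * w ^ 2 = -(φ.lam * φ.a))
    (hlam : (φ.lam : ℂ) = 1 - 2 * (conj (φ.a : ℂ) * w)) {z : ℂ} (hz : ‖z‖ < 1) :
    cayley w (φ.toFun z) = cayley w z + 2 * cayley 1 (-φ.lam) := by
  set u : ℂ := conj (φ.a : ℂ) * w with hu
  have hden := φ.one_sub_ne_zero hz.le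
  have hsub : w - φ.toFun z = (1 - u) * (w - z) / (1 - conj (φ.a : ℂ) * z) := by
    rw [eq_div_iff hden, sub_mul, toFun, div_mul_cancel₀ _ hden]
    linear_combination z * hu - z * hlam + hroot
  have hadd : w + φ.toFun z =
      ((1 - u) * (w + z) + 2 * u * (w - z)) / (1 - conj (φ.a : ℂ) * z) := by
    rw [eq_div_iff hden, add_mul, toFun, div_mul_cancel₀ _ hden]
    linear_combination z * hu + z * hlam - hroot
  have hwz : w - z ≠ 0 := sub_ne_zero_of_norm_lt (hw ▸ hz)
  have hu1 : 1 - u ≠ 0 := φ.one_sub_ne_zero hw.le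
  rw [cayley, hsub, hadd, ← mul_div_assoc, div_div_div_cancel_right₀ hden, cayley, cayley, hlam,
    show 1 - -(1 - 2 * u) = 2 * (1 - u) by ring]
  field_simp
  ring

/-- `φ` acts as translation by `t` in the half-plane coordinate `cayley w`. -/
def DiscAut.IsTranslation (φ : DiscAut) (w : ℂ) (t : ℝ) : Prop :=
  ∀ z : UnitDisc, cayley w (φ.onDisc z) = cayley w z + t

theorem DiscAut.IsParabolic.exists_isTranslation (hφ : φ.IsParabolic) :
    ∃ (w : ℂ) (t : ℝ), ‖w‖ = 1 ∧ t ≠ 0 ∧ φ.IsTranslation w t := by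
  obtain ⟨w, hw, hu0, hroot, hlam⟩ := hφ.exists_double_root
  have hreal : cayley 1 (-φ.lam) = (cayley 1 (-φ.lam)).re := by
    refine Complex.ext rfl ?_
    rw [im_cayley, norm_neg, Circle.norm_coe, norm_one, sub_self, zero_div, ofReal_im]
  refine ⟨w, 2 * (cayley 1 (-φ.lam)).re, hw, fun h => ?_, fun z => ?_⟩
  · have hu1 := φ.one_sub_ne_zero hw.le
    have h0 : cayley 1 (-φ.lam) = 0 := by
      rw [hreal, (mul_eq_zero.mp h).resolve_left two_ne_zero, ofReal_zero]
    rw [cayley, hlam, div_eq_zero_iff, mul_eq_zero, or_iff_right I_ne_zero] at h0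
    rcases h0 with h0 | h0
    · exact hu0 (by linear_combination h0 / 2)
    · exact hu1 (by linear_combination h0 / 2)
  · rw [DiscAut.coe_onDisc, φ.cayley_toFun hw hroot hlam z.norm_lt_one, hreal]
    push_cast
    rfl

end Translation

section Orbit

variable {φ : DiscAut} {w : ℂ} {t : ℝ}

theorem DiscAut.IsTranslation.cayley_iterate_inv (hφ : φ.IsTranslation w t) (c : UnitDisc) (n : ℕ) :
    cayley w (φ.inv.onDisc^[n] c) = cayley w c - n * t := by
  have hinv (z : UnitDisc) : cayley w (φ.inv.onDisc z) = cayley w z - t := by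
    rw [eq_sub_iff_add_eq, ← hφ, φ.onDisc_inv_onDisc]
  induction n with
  | zero => simp
  | succ n ih =>
    rw [Function.iterate_succ_apply', hinv, ih]
    push_cast
    ring

theorem DiscAut.IsTranslation.iterate_inv_ne (hφ : φ.IsTranslation w t) (ht : t ≠ 0) (c : UnitDisc)
    {n : ℕ} (hn : n ≠ 0) : φ.inv.onDisc^[n] c ≠ c := fun h => by
  have hC := hφ.cayley_iterate_inv c n
  rw [h, eq_comm, sub_eq_self] at hC
  exact mul_ne_zero (Nat.cast_ne_zero.mpr hn) (ofReal_ne_zero.mpr ht) hC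

theorem summable_inv_norm_sub_natCast_mul_sq (v : ℂ) {t : ℂ} (ht : t ≠ 0) :
    Summable fun n : ℕ => (‖v - n * t‖ ^ 2)⁻¹ := by
  have h := ((EisensteinSeries.linear_right_summable (-(v / t)) 1 le_rfl).norm.comp_injective
    Nat.cast_injective).mul_left (‖t‖ ^ 2)⁻¹
  refine h.congr fun n => ?_
  have hn : v - n * t = -(t * (-(v / t) + n)) := by
    field_simp
    ring
  rw [hn, norm_neg, norm_mul, mul_pow, mul_inv, Function.comp_apply, Int.cast_one, one_mul,
    norm_inv, norm_zpow, zpow_ofNat, Int.cast_natCast]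

theorem DiscAut.IsTranslation.summable_one_sub_norm_iterate_inv (hφ : φ.IsTranslation w t)
    (hw : ‖w‖ = 1) (ht : t ≠ 0) (c : UnitDisc) :
    Summable fun n : ℕ => 1 - ‖(φ.inv.onDisc^[n] c : ℂ)‖ := by
  refine Summable.of_nonneg_of_le (fun n => ?_) (fun n => ?_)
    ((summable_inv_norm_sub_natCast_mul_sq (cayley w c + I) (ofReal_ne_zero.mpr ht)).mul_left
      (4 * (cayley w c).im))
  · exact sub_nonneg.mpr (UnitDisc.norm_lt_one _).le
  · set b := φ.inv.onDisc^[n] c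
    have hC : cayley w b = cayley w c - n * t := hφ.cayley_iterate_inv c n
    have him : (cayley w b).im = (cayley w c).im := by
      rw [hC, ← ofReal_natCast, ← ofReal_mul, sub_im, ofReal_im, sub_zero]
    calc 1 - ‖(b : ℂ)‖ ≤ 1 - ‖(b : ℂ)‖ ^ 2 :=
          sub_le_sub_left (pow_le_of_le_one (norm_nonneg _) b.norm_lt_one.le two_ne_zero) 1
      _ = 4 * (cayley w c).im * (‖cayley w c + I - n * t‖ ^ 2)⁻¹ := by
          rw [one_sub_norm_sq_eq_cayley hw b.norm_lt_one, him, hC, sub_add_eq_add_sub]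

theorem periodic_qParam_abs {t : ℝ} (ht : t ≠ 0) :
    Function.Periodic (Function.Periodic.qParam |t|) (t : ℂ) := by
  have ht' : (t : ℂ) ≠ 0 := ofReal_ne_zero.mpr ht
  intro z
  rw [Function.Periodic.qParam, Function.Periodic.qParam, Complex.exp_eq_exp_iff_exists_int]
  rcases abs_choice t with h | h <;> rw [h]
  · refine ⟨1, ?_⟩
    push_cast
    field_simp
  · refine ⟨-1, ?_⟩
    push_cast
    field_simp
    ring

theorem exists_qParam_cayley_ne {h : ℝ} (hh : 0 < h) (hw : w ≠ 0) (q : ℂ) :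
    ∃ z, ‖z‖ < ‖w‖ ∧ Function.Periodic.qParam h (cayley w z) ≠ q := by
  by_contra! hq
  have hw' : ‖w‖ ≠ 0 := norm_ne_zero_iff.mpr hw
  have h0 : ‖(0 : ℂ)‖ < ‖w‖ := by rwa [norm_zero, norm_pos_iff]
  have h2 : ‖w / 2‖ < ‖w‖ := by
    rw [norm_div, Complex.norm_ofNat]
    exact half_lt_self (norm_pos_iff.mpr hw)
  have him0 : (cayley w 0).im = 1 := by
    rw [im_cayley, norm_zero, sub_zero, zero_pow two_ne_zero, sub_zero,
      div_self (pow_ne_zero 2 hw')]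
  have him2 : (cayley w (w / 2)).im = 3 := by
    rw [im_cayley, sub_half, norm_div, Complex.norm_ofNat]
    field_simp
    norm_num
  have hlt := (Function.Periodic.norm_qParam_lt_iff hh 1 (cayley w (w / 2))).mpr (by
    rw [him2]
    norm_num)
  rw [hq _ h2, ← hq 0 h0, Function.Periodic.norm_qParam, him0] at hlt
  exact lt_irrefl _ hlt

theorem DiscAut.IsTranslation.exists_mem_hardySpace_vanishing (hφ : φ.IsTranslation w t)
    (hw : ‖w‖ = 1) (ht : t ≠ 0) {p : ℝ} (hp : 1 ≤ p) (c : UnitDisc) :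
    ∃ f ∈ hardySpace p hp, f ≠ 0 ∧ ∀ n : ℕ, f (φ.inv.onDisc^[n] c) = 0 := by
  have ht' : 0 < |t| := abs_pos.mpr ht
  set Q : ℂ → ℂ := fun z => Function.Periodic.qParam |t| (cayley w z) with hQ
  have hQ1 (z : UnitDisc) : ‖Q z‖ ≤ 1 :=
    (Function.Periodic.norm_qParam_lt_one ht' (im_cayley_pos (hw ▸ z.norm_lt_one))).le
  have hQdiff : DifferentiableOn ℂ Q (ball 0 1) :=
    hw ▸ Function.Periodic.differentiable_qParam.comp_differentiableOn (differentiableOn_cayley w)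
  refine ⟨fun z => Q z - Q c, mem_hardySpace_of_bounded hp (C := 1 + 1) ?_ fun z => ?_,
    fun hzero => ?_, fun n => ?_⟩
  · exact (hQdiff.sub_const (Q c)).congr (extend_eqOn fun _ => rfl)
  · exact (norm_sub_le _ _).trans (add_le_add (hQ1 z) (hQ1 c))
  · obtain ⟨z, hz, hne⟩ :=
      exists_qParam_cayley_ne ht' (norm_ne_zero_iff.mp (hw ▸ one_ne_zero)) (Q c)
    exact hne (sub_eq_zero.mp (congrFun hzero (UnitDisc.mk z (hw ▸ hz))))
  · rw [sub_eq_zero]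
    simp only [hQ, hφ.cayley_iterate_inv, (periodic_qParam_abs ht).sub_nat_mul_eq]

end Orbit

section IteratedRange

variable {φ : DiscAut} {p : ℝ}

theorem mem_map_pow_of_vanishing (hp : 1 ≤ p) (ψ : DiscAut)
    (hne : ∀ n : ℕ, n ≠ 0 → φ.inv.onDisc^[n] ψ.a ≠ ψ.a) (n : ℕ) {f : UnitDisc → ℂ}
    (hf : f ∈ hardySpace p hp) (h0 : ∀ k < n, f (φ.inv.onDisc^[k] ψ.a) = 0) :
    f ∈ (hardySpace p hp).map ((mulAut ψ * weightedCompOp p φ) ^ n) := by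
  induction n generalizing f with
  | zero => exact ⟨f, hf, rfl⟩
  | succ n ih =>
    obtain ⟨g, hg, rfl⟩ := (mem_map_mulAut_mul_weightedCompOp φ ψ hp).mpr ⟨hf, h0 0 n.succ_pos⟩
    obtain ⟨k, hk, rfl⟩ := ih hg fun j hj => by
      have hj0 := ((mulAut_mul_weightedCompOp_apply_eq_zero_iff φ ψ).mp
        (h0 (j + 1) (Nat.succ_lt_succ hj))).resolve_left (hne (j + 1) j.succ_ne_zero)
      rwa [Function.iterate_succ_apply', φ.onDisc_inv_onDisc] at hj0
    exact ⟨k, hk, by rw [pow_succ']; rfl⟩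

end IteratedRange

end HardyIsometry

theorem theorem4_general (p : ℝ) (hp : 1 ≤ p) (φ ψ : HardyIsometry.DiscAut)
    (hφ : φ.IsParabolic) :
    HardyIsometry.IsCodimOneIsometry p hp
      (HardyIsometry.mulOp (fun z => (ψ.onDisc z : ℂ)) * HardyIsometry.weightedCompOp p φ) ∧
    ¬ HardyIsometry.IsCrownover p hp
      (HardyIsometry.mulOp (fun z => (ψ.onDisc z : ℂ)) * HardyIsometry.weightedCompOp p φ) ∧
    ∃ b : ℕ → Complex.UnitDisc,
      (∀ (n : ℕ) (z : Complex.UnitDisc), ψ.onDisc (φ.onDisc^[n] z) = 0 ↔ z = b n) ∧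
      Summable (fun n => 1 - ‖(b n : ℂ)‖) := by
  obtain ⟨w, t, hw, ht, hT⟩ := hφ.exists_isTranslation
  refine ⟨HardyIsometry.isCodimOneIsometry_mulAut_mul_weightedCompOp φ ψ hp, fun hC => ?_,
    fun n => φ.inv.onDisc^[n] ψ.a, φ.onDisc_iterate_eq_zero_iff ψ,
    hT.summable_one_sub_norm_iterate_inv hw ht ψ.a⟩
  obtain ⟨f, hf, hf0, hfb⟩ := hT.exists_mem_hardySpace_vanishing hw ht hp ψ.a
  have hmem : f ∈ ⨅ n : ℕ, (HardyIsometry.hardySpace p hp).map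
      ((HardyIsometry.mulAut ψ * HardyIsometry.weightedCompOp p φ) ^ (n + 1)) :=
    (Submodule.mem_iInf _).mpr fun n => HardyIsometry.mem_map_pow_of_vanishing hp ψ
      (fun _ => hT.iterate_inv_ne ht ψ.a) (n + 1) hf fun k _ => hfb k
  exact hf0 ((Submodule.mem_bot ℂ).mp (hC.2 ▸ hmem))

theorem theorem4 (p : ℝ) (hp : 1 ≤ p) (hp2 : p ≠ 2)
    (φ ψ : HardyIsometry.DiscAut) (hφ : φ.IsParabolic) :
    HardyIsometry.IsCodimOneIsometry p hp
      (HardyIsometry.mulOp (fun z => (ψ.onDisc z : ℂ)) * HardyIsometry.weightedCompOp p φ) ∧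
    ¬ HardyIsometry.IsCrownover p hp
      (HardyIsometry.mulOp (fun z => (ψ.onDisc z : ℂ)) * HardyIsometry.weightedCompOp p φ) ∧
    ∃ b : ℕ → Complex.UnitDisc,
      (∀ (n : ℕ) (z : Complex.UnitDisc), ψ.onDisc (φ.onDisc^[n] z) = 0 ↔ z = b n) ∧
      Summable (fun n => 1 - ‖(b n : ℂ)‖) :=
  theorem4_general p hp φ ψ hφ
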